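/- For sets $A,B\subset\mathbb{E}^n$ and a family $\mathcal{B}$ of subsets of Euclidean space $\mathbb{E}^n$, let $C(A,\mathcal{B})$ be the smallest number of translates of elements of $\mathcal{B}$ required to cover $A$ (with value $\infty$ if no finite number suffices), and let $C(A,B)=C(A,\{B\})$. For families $\mathcal{A},\mathcal{B}$ of subsets of $\mathbb{E}^n$ let $C(\mathcal{A},\mathcal{B})=\sup_{A\in\mathcal{A}}C(A,\mathcal{B})$. A convex body is a compact convex set with non-empty interior. Let $H_n$ be the supremum of $C(K,\operatorname{int}K)$ over all convex bodies $K\subset\mathbb{E}^n$. Let $B_{n-2,n}$ be the $(n-2)$-skeleton of the unit cube $[0,1]^n$, i.e. the set of all points of the cube having at least two coordinates equal to $0$ or $1$. Let $e_i$ be the $i$-th basic unit vector, let $$\mathcal{A}_n=\Big\{\bigcup_{i=1}^n\{x_i,\,x_i+e_i\}:\ x_i,\ x_i+e_i\in[0,1]^n\ (1\le i\le n)\Big\},$$ $$\mathcal{P}_n=\Big\{\prod_{i=1}^n[x_i,x_i+\delta_i]:\ x_i\in\mathbb{R},\ \delta_i\ge0,\ \sum_{i=1}^n\delta_i<1\Big\},$$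 and let $C_n=C\big(\{A\cup B_{n-2,n}:A\in\mathcal{A}_n\},\,\mathcal{P}_n\big)$. **Proposition.** For every $n\ge3$, $H_n\le C_n$. -/

import Mathlib

open scoped Pointwise

namespace BoxCovering

/-- `n`-dimensional Euclidean space. -/
abbrev E (n : ℕ) : Type := EuclideanSpace ℝ (Fin n)

/-- The set `A` can be covered by `m` translates of elements of the family `𝓑`
(elements may be used several times, with different translation vectors). -/
def IsCoverable {n : ℕ} (A : Set (E n)) (𝓑 : Set (Set (E n))) (m : ℕ) : Prop :=
  ∃ (B : Fin m → Set (E n)) (v : Fin m → E n),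
    (∀ j, B j ∈ 𝓑) ∧ A ⊆ ⋃ j, v j +ᵥ B j

/-- `C(A, 𝓑)` for a set `A` and a family `𝓑`: the smallest number of translates of elements
of `𝓑` required to cover `A` (`⊤` if no finite number suffices). -/
noncomputable def coverFamily {n : ℕ} (A : Set (E n)) (𝓑 : Set (Set (E n))) : ℕ∞ :=
  ⨅ (m : ℕ) (_ : IsCoverable A 𝓑 m), (m : ℕ∞)

/-- `C(A, B)` for two sets: the smallest number of translates of `B` required to cover `A`. -/
noncomputable def coverSet {n : ℕ} (A B : Set (E n)) : ℕ∞ := coverFamily A {B}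

/-- `C(𝓐, 𝓑)` for two families: the supremum of `C(A, 𝓑)` over `A ∈ 𝓐`. -/
noncomputable def coverFamilies {n : ℕ} (𝓐 𝓑 : Set (Set (E n))) : ℕ∞ :=
  ⨆ A ∈ 𝓐, coverFamily A 𝓑

/-- The Hadwiger number `H_n`: the supremum of `C(K, int K)` over all convex bodies `K`, that is,
compact convex subsets of `n`-dimensional Euclidean space with nonempty interior. -/
noncomputable def hadwigerNumber (n : ℕ) : ℕ∞ :=
  ⨆ (K : ConvexBody (E n)) (_ : (interior (K : Set (E n))).Nonempty),
    coverSet (K : Set (E n)) (interior (K : Set (E n)))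

/-- The unit cube `[0,1]^n`. -/
def unitCube (n : ℕ) : Set (E n) := {x | ∀ i, x i ∈ Set.Icc (0 : ℝ) 1}

/-- The `k`-skeleton of the unit cube `[0,1]^n` (for `k ≤ n`): the points of the cube having at
least `n - k` coordinates equal to `0` or `1`. -/
def skeleton (k n : ℕ) : Set (E n) :=
  {x | x ∈ unitCube n ∧ n - k ≤ {i : Fin n | x i = 0 ∨ x i = 1}.ncard}

/-- The `i`-th basic unit vector. -/
noncomputable abbrev basisVec {n : ℕ} (i : Fin n) : E n := EuclideanSpace.single i (1 : ℝ)

/-- The collection of the sets `⋃ i, {x_i, x_i + e_i}` with all `x_i, x_i + e_i` in the cube. -/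
def pairConfigurations (n : ℕ) : Set (Set (E n)) :=
  {A | ∃ x : Fin n → E n,
    (∀ i, x i ∈ unitCube n ∧ x i + basisVec i ∈ unitCube n) ∧
      A = ⋃ i, {x i, x i + basisVec i}}

/-- The box `∏ i, [x_i, x_i + δ_i]`. -/
def box {n : ℕ} (x : E n) (δ : Fin n → ℝ) : Set (E n) :=
  {y | ∀ i, y i ∈ Set.Icc (x i) (x i + δ i)}

/-- The family of all boxes (possibly degenerate) with total side length less than `1`. -/
def smallBoxes (n : ℕ) : Set (Set (E n)) :=
  {P | ∃ (x : E n) (δ : Fin n → ℝ), (∀ i, 0 ≤ δ i) ∧ ∑ i, δ i < 1 ∧ P = box x δ}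

/-- The covering number `C_n = C(𝓐_n ∪ B_{n-2,n}, 𝓟_n)`, used for `n ≥ 2`: here
`𝓐_n ∪ B_{n-2,n}` is the collection of the sets `A ∪ B_{n-2,n}` with `A ∈ 𝓐_n`. -/
noncomputable def boxCoverNumber (n : ℕ) : ℕ∞ :=
  coverFamilies ((fun A => A ∪ skeleton (n - 2) n) '' pairConfigurations n) (smallBoxes n)

end BoxCovering

namespace BoxCovering

open Module Filter Topology Set

section Auerbach

variable {ι F : Type*} [Fintype ι] [DecidableEq ι] [NormedAddCommGroup F] [NormedSpace ℝ F]

/-! Covering numbers by translates of the interior are affine invariant, so an Auerbach basis for `K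
- K` allows `K` to lie in the unit cube and contain a pair `a i`, `a i + e i` for each `i`. Then
every box in `smallBoxes n` has a translate inside `interior K` (`exists_vadd_box_subset_interior`).

Take a cover of the pairs and the skeleton by such boxes. Each `x ∈ K` lies on a segment from some
`p ∈ K` to a covered point `y` (`exists_mem_union_skeleton`). The vector `w` moving the box of `y`
into the interior also moves `x` inwards, after scaling. Thus finitely many directions illuminate
`K`, and compactness gives one scale for all points. -/

lemma continuous_basis_det (e : Basis ι ℝ F) : Continuous (fun v : ι → F => e.det v) := by
  have : FiniteDimensional ℝ F := e.finiteDimensional_of_finite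
  simp only [Basis.det_apply]
  refine Continuous.matrix_det (continuous_matrix fun i j => ?_)
  exact ((e.coord i).continuous_of_finiteDimensional).comp (continuous_apply j)

/-- Auerbach's lemma: a compact neighbourhood of the origin contains a basis with respect to which
all its points have coordinates of absolute value at most `1`. -/
lemma exists_basis_abs_coord_le_one (e : Basis ι ℝ F) {D : Set F} (hD : IsCompact D)
    (h0 : D ∈ 𝓝 0) :
    ∃ b : Basis ι ℝ F, (∀ i, b i ∈ D) ∧ ∀ u ∈ D, ∀ i, |b.coord i u| ≤ 1 := by
  obtain ⟨t, htD, ht0⟩ : ∃ t : ℝ, (∀ i, t • e i ∈ D) ∧ 0 < t := by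
    have h : ∀ᶠ t : ℝ in 𝓝 0, ∀ i, t • e i ∈ D := by
      refine eventually_all.2 fun i => ?_
      have : Tendsto (fun t : ℝ => t • e i) (𝓝 0) (𝓝 0) :=
        (continuous_id.smul continuous_const).tendsto' _ _ (by simp)
      exact this h0
    exact ((h.filter_mono nhdsWithin_le_nhds).and
      (self_mem_nhdsWithin : Ioi (0 : ℝ) ∈ 𝓝[>] 0)).exists
  obtain ⟨v, hvD, hmax⟩ := (isCompact_univ_pi fun _ : ι => hD).exists_isMaxOn
    ⟨fun i => t • e i, fun i _ => htD i⟩ (continuous_basis_det e).abs.continuousOn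
  have hpos : 0 < |e.det v| := by
    refine lt_of_lt_of_le ?_ (hmax (show (fun i => t • e i) ∈ _ from fun i _ => htD i))
    have : e.det (fun i => t • e i) = t ^ Fintype.card ι := by
      have := e.det.map_smul_univ (fun _ => t) e
      simpa [e.det_self] using this
    simp only [this]
    positivity
  obtain ⟨hli, hsp⟩ := e.is_basis_iff_det.2 (isUnit_iff_ne_zero.2 (abs_pos.1 hpos))
  refine ⟨Basis.mk hli hsp.ge, fun i => by simpa using hvD i (mem_univ i), fun u hu i => ?_⟩
  -- Cramer's rule: replacing `v i` by `u` multiplies the determinant by the `i`-th coordinate of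
  -- `u`, so maximality of `|det v|` bounds that coordinate.
  have h1 := congrArg (fun f => f u) (e.det_smul_mk_coord_eq_det_update hli hsp.ge i)
  have h2 : |e.det (Function.update v i u)| ≤ |e.det v| := by
    refine hmax (show Function.update v i u ∈ _ from fun j _ => ?_)
    rcases eq_or_ne j i with rfl | hj
    · simpa using hu
    · simpa [hj] using hvD j (mem_univ j)
  have h3 : e.det v * (Basis.mk hli hsp.ge).coord i u = e.det (Function.update v i u) := by
    simpa using h1
  rw [← h3, abs_mul] at h2
  exact le_of_mul_le_mul_left (by simpa using h2) hpos

end Auerbach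

variable {n : ℕ}

/-- Every compact set with interior points has an affine image in the unit cube that contains a
unit segment's endpoints in each coordinate direction. -/
lemma exists_affine_image_subset_unitCube {K : Set (E n)} (hK : IsCompact K)
    (hi : (interior K).Nonempty) :
    ∃ (L : E n ≃L[ℝ] E n) (c : E n) (a : Fin n → E n), (∀ x ∈ K, L x + c ∈ unitCube n) ∧
      ∀ i, (∃ y ∈ K, L y + c = a i) ∧ ∃ y ∈ K, L y + c = a i + basisVec i := by
  have h0 : K - K ∈ 𝓝 (0 : E n) := by
    obtain ⟨p, hp⟩ := hi
    have : Tendsto (fun u : E n => p + u) (𝓝 0) (𝓝 p) :=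
      (continuous_const.add continuous_id).tendsto' _ _ (by simp)
    filter_upwards [this (mem_interior_iff_mem_nhds.1 hp)] with u hu
    exact ⟨p + u, hu, p, interior_subset hp, by simp⟩
  have hKK : IsCompact (K - K) := by
    rw [← sub_image_prod]
    exact (hK.prod hK).image continuous_sub
  obtain ⟨b, hbD, hb⟩ := exists_basis_abs_coord_le_one
    (EuclideanSpace.basisFun (Fin n) ℝ).toBasis hKK h0
  choose q hq p hp hqp using hbD
  let L : E n ≃L[ℝ] E n :=
    (b.equivFun.trans (WithLp.linearEquiv 2 ℝ (Fin n → ℝ)).symm).toContinuousLinearEquiv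
  have hL : ∀ x i, L x i = b.coord i x := fun x i => rfl
  have hLb : ∀ i, L (b i) = basisVec i := by
    intro i
    ext j
    simp [hL, Finsupp.single_apply, eq_comm]
  let c : E n := WithLp.toLp 2 fun i => -(b.coord i (p i))
  have hsub : ∀ x ∈ K, ∀ y ∈ K, ∀ i, b.coord i x - b.coord i y ≤ 1 := fun x hx y hy i => by
    rw [← map_sub]
    exact (le_abs_self _).trans (hb _ ⟨x, hx, y, hy, rfl⟩ i)
  refine ⟨L, c, fun i => L (p i) + c, fun x hx i => ?_, fun i =>
    ⟨⟨p i, hp i, rfl⟩, q i, hq i, ?_⟩⟩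
  · have h1 : b.coord i (q i) - b.coord i (p i) = 1 := by
      rw [← map_sub, show q i - p i = b i from hqp i]
      simp
    have h2 := hsub x hx (p i) (hp i) i
    have h3 := hsub (q i) (hq i) x hx i
    have h4 : (L x + c) i = b.coord i x - b.coord i (p i) := by
      simp only [PiLp.add_apply, hL, c, sub_eq_add_neg]
    rw [h4]
    constructor <;> linarith
  · rw [← hLb, ← show q i - p i = b i from hqp i, map_sub]
    module

/-! ### Small boxes inside a normalized body -/

/-- A box of total side length less than `1` fits, after translation, into the interior of any
convex set with interior points that contains a unit segment in each coordinate direction. -/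
lemma exists_vadd_box_subset_interior {K : Set (E n)} (hc : Convex ℝ K)
    (hi : (interior K).Nonempty) {a : Fin n → E n}
    (ha : ∀ i, a i ∈ K ∧ a i + basisVec i ∈ K) (x : E n) {δ : Fin n → ℝ}
    (h1 : ∑ i, δ i < 1) : ∃ w : E n, ∀ y ∈ box x δ, y + w ∈ interior K := by
  obtain ⟨p, hp⟩ := hi
  set r := 1 - ∑ i, δ i with hr
  have hrpos : 0 < r := by linarith
  refine ⟨(∑ i, δ i • a i) + r • p - x, fun y hy => ?_⟩
  set θ : Fin n → ℝ := fun i => y i - x i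
  have hθ : ∀ i, 0 ≤ θ i ∧ θ i ≤ δ i := fun i => by
    have := hy i
    exact ⟨by linarith [this.1], by linarith [this.2]⟩
  have hyx : y - x = ∑ i, θ i • basisVec i := by
    ext j
    simp [θ, Finset.sum_apply, Pi.single_apply]
  -- The weight `δ i` is split between the endpoints of the `i`-th segment; the remaining weight `r`
  -- goes to an interior point.
  let z : E n := ∑ i, ((δ i - θ i) • a i + θ i • (a i + basisVec i))
  have hz : y + ((∑ i, δ i • a i) + r • p - x) = z + r • p := by
    have : z = (∑ i, δ i • a i) + ∑ i, θ i • basisVec i := by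
      rw [← Finset.sum_add_distrib]
      refine Finset.sum_congr rfl fun i _ => ?_
      module
    rw [this, ← hyx]
    abel
  rw [hz]
  have hsub : (fun u => z + r • u) '' interior K ⊆ K := by
    rintro _ ⟨u, hu, rfl⟩
    have := hc.sum_mem (t := Finset.univ)
      (w := fun o : Option (Fin n ⊕ Fin n) =>
        o.elim r (Sum.elim (fun i => δ i - θ i) θ))
      (z := fun o => o.elim u (Sum.elim a fun i => a i + basisVec i)) ?_ ?_ ?_
    · simpa [Fintype.sum_option, z, Finset.sum_add_distrib, add_comm, add_left_comm, add_assoc]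
        using this
    · rintro (_ | i | i) -
      · exact hrpos.le
      · exact sub_nonneg.2 (hθ i).2
      · exact (hθ i).1
    · simp [Fintype.sum_option, hr]
    · rintro (_ | i | i) -
      · exact interior_subset hu
      · exact (ha i).1
      · exact (ha i).2
  have hopen : IsOpen ((fun u => z + r • u) '' interior K) :=
    ((Homeomorph.smulOfNeZero r hrpos.ne').trans (Homeomorph.addLeft z)).isOpenMap _
      isOpen_interior
  exact interior_maximal hsub hopen ⟨p, hp, rfl⟩

/-! ### Pushing points to the pairs or the skeleton -/

/-- Starting from a point of the cube, one can move along a nonzero vector up to a point of the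
cube at which one of the changing coordinates is `0` or `1`. -/
lemma exists_add_smul_mem_unitCube {z d : E n} (hz : z ∈ unitCube n) (hd : d ≠ 0) :
    ∃ t : ℝ, 0 ≤ t ∧ z + t • d ∈ unitCube n ∧
      ∃ j, d j ≠ 0 ∧ ((z + t • d) j = 0 ∨ (z + t • d) j = 1) := by
  -- The time at which coordinate `j` reaches 0 or 1, meaningful only if `d j ≠ 0`.
  let τ : Fin n → ℝ := fun j => if 0 < d j then (1 - z j) / d j else -z j / d j
  have hne : (Finset.univ.filter fun j => d j ≠ 0).Nonempty := by
    by_contra h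
    apply hd
    ext j
    by_contra hj
    exact h ⟨j, by simpa using hj⟩
  obtain ⟨j, hj, hmin⟩ := Finset.exists_min_image _ τ hne
  have hj : d j ≠ 0 := by simpa using hj
  have hτ : ∀ k, 0 ≤ τ j ∧ (d k ≠ 0 → τ j ≤ τ k) := by
    refine fun k => ⟨?_, fun hk => hmin k (by simpa using hk)⟩
    simp only [τ]
    split_ifs with h
    · exact div_nonneg (by linarith [(hz j).2]) h.le
    · exact div_nonneg_of_nonpos (by linarith [(hz j).1]) (not_lt.1 h)
  refine ⟨τ j, (hτ j).1, fun k => ?_, j, hj, ?_⟩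
  · have hk0 := (hz k).1
    have hk1 := (hz k).2
    have ht := (hτ k).1
    simp only [PiLp.add_apply, PiLp.smul_apply, smul_eq_mul, mem_Icc]
    rcases lt_trichotomy (d k) 0 with h | h | h
    · have h1 := (hτ k).2 h.ne
      simp only [τ, if_neg h.not_gt] at h1 ⊢
      rw [le_div_iff_of_neg h] at h1
      exact ⟨by linarith, by linarith [mul_nonpos_of_nonneg_of_nonpos ht h.le]⟩
    · simp [h, hk0, hk1]
    · have h1 := (hτ k).2 h.ne'
      rw [show τ k = (1 - z k) / d k from if_pos h, le_div_iff₀ h] at h1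
      exact ⟨by linarith [mul_nonneg ht h.le], by linarith⟩
  · simp only [PiLp.add_apply, PiLp.smul_apply, smul_eq_mul, τ]
    split_ifs with h
    · right
      field_simp
      ring
    · left
      field_simp
      ring

/-- Every point `x` of a convex set `K` in the cube containing the pairs `a i`, `a i + e i` can be
pushed away from a point of `K` onto one of the pairs or onto the `(n - 2)`-skeleton. -/
lemma exists_mem_union_skeleton (hn : 2 ≤ n) {K : Set (E n)} (hc : Convex ℝ K)
    (hcube : K ⊆ unitCube n) {a : Fin n → E n} (ha : ∀ i, a i ∈ K ∧ a i + basisVec i ∈ K)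
    {x : E n} (hx : x ∈ K) :
    ∃ y ∈ (⋃ i, {a i, a i + basisVec i}) ∪ skeleton (n - 2) n,
      ∃ l : ℝ, 0 ≤ l ∧ ∃ p ∈ K, y = x + l • (x - p) := by
  have hai : ∀ i, a i i = 0 := fun i => by
    have h1 := (hcube (ha i).1 i).1
    have h2 := (hcube (ha i).2 i).2
    simp at h2
    linarith
  -- Chosen to share its `i`-th coordinate with `x`, so moving along `x - q i` keeps that coordinate
  -- fixed.
  let q : Fin n → E n := fun i => a i + x i • basisVec i
  have hq : ∀ i, q i ∈ K := fun i => by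
    have h := hc (ha i).1 (ha i).2 (sub_nonneg.2 (hcube hx i).2) (hcube hx i).1 (by ring)
    convert h using 1
    simp only [q]
    module
  have hqi : ∀ i, (x - q i) i = 0 := fun i => by simp [q, hai]
  by_cases hex : ∃ i, x = q i
  · obtain ⟨i, hi⟩ := hex
    rcases (hcube hx i).1.eq_or_lt with h0 | h0
    · refine ⟨x, Or.inl (mem_iUnion.2 ⟨i, Or.inl ?_⟩), 0, le_rfl, x, hx, by simp⟩
      rw [hi]
      simp [q, ← h0]
    · refine ⟨a i + basisVec i, Or.inl (mem_iUnion.2 ⟨i, Or.inr rfl⟩), (1 - x i) / x i,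
        div_nonneg (sub_nonneg.2 (hcube hx i).2) h0.le, a i, (ha i).1, ?_⟩
      have h1 : x - a i = x i • basisVec i := by
        nth_rewrite 1 [hi]
        simp [q]
      rw [h1, smul_smul, div_mul_cancel₀ _ h0.ne']
      nth_rewrite 1 [hi]
      simp only [q]
      module
  · push Not at hex
    -- The first move makes coordinate `j` equal to 0 or 1. The second, along `x - q j`, preserves
    -- it and must stop at another coordinate `k`.
    obtain ⟨t, ht, hz, j, -, hzj⟩ :=
      exists_add_smul_mem_unitCube (hcube hx) (sub_ne_zero.2 (hex ⟨0, by omega⟩))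
    obtain ⟨s, hs, hw, k, hk, hwk⟩ :=
      exists_add_smul_mem_unitCube hz (sub_ne_zero.2 (hex j))
    set i : Fin n := ⟨0, by omega⟩
    refine ⟨x + t • (x - q i) + s • (x - q j), Or.inr ⟨hw, ?_⟩, t + s, by positivity, ?_⟩
    · have hjk : j ≠ k := by
        rintro rfl
        exact hk (hqi j)
      have hwj : (x + t • (x - q i) + s • (x - q j)) j = (x + t • (x - q i)) j := by
        rw [PiLp.add_apply, PiLp.smul_apply, hqi]
        simp
      have hsub : ({j, k} : Set (Fin n)) ⊆ {m | (x + t • (x - q i) + s • (x - q j)) m = 0 ∨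
          (x + t • (x - q i) + s • (x - q j)) m = 1} := by
        rintro m (rfl | rfl)
        · simpa only [mem_ofPred_eq, hwj] using hzj
        · exact hwk
      have := ncard_le_ncard hsub
      rw [ncard_pair hjk] at this
      omega
    · rcases (add_nonneg ht hs).eq_or_lt with h | h
      · have ht0 : t = 0 := by linarith
        have hs0 : s = 0 := by linarith
        exact ⟨x, hx, by simp [ht0, hs0]⟩
      · refine ⟨(t / (t + s)) • q i + (s / (t + s)) • q j, hc (hq i) (hq j) (by positivity)
          (by positivity) (by field_simp), ?_⟩
        have h1 : (t + s) * (t / (t + s)) = t := by field_simp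
        have h2 : (t + s) * (s / (t + s)) = s := by field_simp
        rw [smul_sub (t + s), smul_add (t + s), smul_smul (t + s), smul_smul (t + s), h1, h2]
        module

/-! ### From illumination to covering -/

/-- If finitely many directions illuminate every point of a compact convex set, then as many
translates of its interior cover it. -/
lemma exists_smul_add_mem_interior {ι : Type*} {K : Set (E n)} (hK : IsCompact K)
    (hc : Convex ℝ K) (w : ι → E n)
    (h : ∀ x ∈ K, ∃ j, ∃ t : ℝ, 0 < t ∧ x + t • w j ∈ interior K) :
    ∃ t : ℝ, ∀ x ∈ K, ∃ j, x + t • w j ∈ interior K := by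
  have hmono : ∀ x ∈ K, ∀ j, ∀ s t : ℝ, 0 < s → s ≤ t → x + t • w j ∈ interior K →
      x + s • w j ∈ interior K := by
    intro x hx j s t hs hst hxt
    have ht := hs.trans_le hst
    have := hc.combo_interior_self_mem_interior hxt hx (a := s / t) (b := 1 - s / t)
      (by positivity) (sub_nonneg.2 ((div_le_one ht).2 hst)) (by ring)
    convert this using 1
    rw [smul_add, smul_smul, div_mul_cancel₀ _ ht.ne']
    module
  -- These open sets grow as `t` decreases, so a single one covers `K`.
  let U : Ioi (0 : ℝ) → Set (E n) := fun t =>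
    ⋃ (j : ι) (s : ℝ) (_ : (t : ℝ) ≤ s), {x | x + s • w j ∈ interior K}
  have : Nonempty (Ioi (0 : ℝ)) := ⟨⟨1, mem_Ioi.2 one_pos⟩⟩
  obtain ⟨⟨t, ht⟩, hKt⟩ := hK.elim_directed_cover U
    (fun t => isOpen_iUnion fun j => isOpen_iUnion fun s => isOpen_iUnion fun _ =>
      isOpen_interior.preimage (continuous_id.add continuous_const))
    (fun x hx => by
      obtain ⟨j, t, ht, hx⟩ := h x hx
      simp only [U, mem_iUnion]
      exact ⟨⟨t, ht⟩, j, t, le_rfl, hx⟩)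
    (by
      have hU : ∀ s t : Ioi (0 : ℝ), s ≤ t → U t ⊆ U s := fun s t hst x hx => by
        simp only [U, mem_iUnion] at hx ⊢
        obtain ⟨j, r, hr, hx⟩ := hx
        exact ⟨j, r, le_trans hst hr, hx⟩
      exact fun s t => ⟨min s t, hU _ _ (min_le_left _ _), hU _ _ (min_le_right _ _)⟩)
  refine ⟨t, fun x hx => ?_⟩
  have := hKt hx
  simp only [U, mem_iUnion] at this
  obtain ⟨j, s, hs, hxs⟩ := this
  exact ⟨j, hmono x hx j t s ht hs hxs⟩

lemma isCoverable_interior (hn : 2 ≤ n) {K : Set (E n)} (hK : IsCompact K) (hc : Convex ℝ K)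
    (hcube : K ⊆ unitCube n) (hi : (interior K).Nonempty) {a : Fin n → E n}
    (ha : ∀ i, a i ∈ K ∧ a i + basisVec i ∈ K) {m : ℕ}
    (hm : IsCoverable ((⋃ i, {a i, a i + basisVec i}) ∪ skeleton (n - 2) n) (smallBoxes n) m) :
    ∃ v : Fin m → E n, ∀ x ∈ K, ∃ j, x + v j ∈ interior K := by
  obtain ⟨B, u, hB, hcov⟩ := hm
  have hw : ∀ j, ∃ w : E n, ∀ y ∈ u j +ᵥ B j, y + w ∈ interior K := fun j => by
    obtain ⟨x, δ, -, h1, hBj⟩ := hB j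
    obtain ⟨w, hw⟩ := exists_vadd_box_subset_interior hc hi ha x h1
    refine ⟨w - u j, ?_⟩
    rintro _ ⟨y, hy, rfl⟩
    rw [hBj] at hy
    convert hw y hy using 1
    simp only [vadd_eq_add]
    abel
  choose w hw using hw
  obtain ⟨t, ht⟩ := exists_smul_add_mem_interior hK hc w fun x hx => by
    obtain ⟨y, hy, l, hl, p, hp, rfl⟩ := exists_mem_union_skeleton hn hc hcube ha hx
    obtain ⟨j, hj⟩ := mem_iUnion.1 (hcov hy)
    have hpos : 0 < 1 + l := by linarith
    refine ⟨j, (1 + l)⁻¹, by positivity, ?_⟩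
    -- Since `x` is the mean of `y` and `p` with these weights, replacing `y` by `y + w j` shifts
    -- `x` by `(1 + l)⁻¹ • w j`.
    have := hc.combo_interior_self_mem_interior (hw j _ hj) hp (a := (1 + l)⁻¹)
      (b := (1 + l)⁻¹ * l) (by positivity) (by positivity) (by field_simp)
    convert this using 1
    have h1 : x = ((1 + l)⁻¹ * (1 + l)) • x := by rw [inv_mul_cancel₀ hpos.ne', one_smul]
    nth_rewrite 1 [h1]
    module
  exact ⟨fun j => t • w j, ht⟩

lemma coverSet_interior_le_boxCoverNumber (hn : 2 ≤ n) {K : Set (E n)} (hK : IsCompact K)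
    (hc : Convex ℝ K) (hi : (interior K).Nonempty) :
    coverSet K (interior K) ≤ boxCoverNumber n := by
  obtain ⟨L, c, a, hcube, ha⟩ := exists_affine_image_subset_unitCube hK hi
  let f : E n ≃ₜ E n := L.toHomeomorph.trans (Homeomorph.addRight c)
  have hf : ∀ x, f x = L x + c := fun x => rfl
  have hfi : interior (f '' K) = f '' interior K := (f.image_interior K).symm
  have hfc : Convex ℝ (f '' K) := by
    have : f '' K = (fun x => x + c) '' (L.toLinearMap '' K) := by
      rw [image_image]
      rfl
    rw [this]
    simpa [add_comm] using (hc.linear_image L.toLinearMap).translate c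
  have hcube' : f '' K ⊆ unitCube n := by
    rintro _ ⟨x, hx, rfl⟩
    exact hcube x hx
  have ha' : ∀ i, a i ∈ f '' K ∧ a i + basisVec i ∈ f '' K := fun i => ha i
  have hmem : (⋃ i, {a i, a i + basisVec i}) ∪ skeleton (n - 2) n ∈
      (fun A => A ∪ skeleton (n - 2) n) '' pairConfigurations n :=
    ⟨_, ⟨a, fun i => ⟨hcube' (ha' i).1, hcube' (ha' i).2⟩, rfl⟩, rfl⟩
  refine le_trans ?_ (le_iSup₂_of_le _ hmem le_rfl)
  refine le_iInf₂ fun m hm => ?_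
  obtain ⟨v, hv⟩ := isCoverable_interior hn (hK.image f.continuous) hfc hcube'
    (hfi ▸ hi.image f) ha' hm
  refine iInf₂_le m ⟨fun _ => interior K, fun j => -L.symm (v j), fun _ => rfl, fun x hx => ?_⟩
  obtain ⟨j, hj⟩ := hv (f x) ⟨x, hx, rfl⟩
  rw [hfi] at hj
  obtain ⟨y, hy, hyx⟩ := hj
  refine mem_iUnion.2 ⟨j, y, hy, ?_⟩
  have h1 : L y = L x + v j := by
    rw [hf, hf] at hyx
    exact add_right_cancel (b := c) (by rw [hyx]; abel)
  have h2 : y = x + L.symm (v j) := by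
    apply L.injective
    simp [h1]
  simp [h2]

end BoxCovering

theorem mainTheorem2 (n : ℕ) (hn : 3 ≤ n) :
    BoxCovering.hadwigerNumber n ≤ BoxCovering.boxCoverNumber n :=
  iSup₂_le fun K hK =>
    BoxCovering.coverSet_interior_le_boxCoverNumber (by omega) K.isCompact K.convex hK
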